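/- Let $m>2$ be an even integer, $q=2^m$, and let $\mathbb F_q$ be the finite field with $q$ elements and $\mathbb F_q^*=\mathbb F_q\setminus\{0\}$. Let $\chi(x)=(-1)^{\mathrm{Tr}(x)}$ be the canonical additive character of $\mathbb F_q$, where $\mathrm{Tr}$ is the trace from $\mathbb F_q$ to $\mathbb F_2$, and for $a\in\mathbb F_q^*$ let $$K(a)=\sum_{x\in\mathbb F_q^*}\chi(x+ax^{-1})$$ be the Kloosterman sum. For $k\in\{7,19,11,23\}$ let $N(k)$ be the number of $a\in\mathbb F_q^*$ with $K(a)\equiv k\pmod{24}$. Then the numbers $N(k)-3\cdot 2^{m-4}$ are given by $$\begin{array}{c|cccc} m \bmod 24 & N(7)-3\cdot2^{m-4} & N(19)-3\cdot2^{m-4} & N(11)-3\cdot2^{m-4} & N(23)-3\cdot2^{m-4}\\ \hline 0 & 2^{\frac m2-3}-1 & 2^{\frac m2-3} & -2^{\frac m2-3} & -2^{\frac m2-3}\\ \pm6 & -2^{\frac m2-2}-1 & 0 & 2^{\frac m2-2} & 0\\ 12 & 3\cdot2^{\frac m2-3}-1 & -2^{\frac m2-3} & -3\cdot2^{\frac m2-3}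 & 2^{\frac m2-3}\\ \pm8 & -2^{\frac m2-2}-1 & 2^{\frac m2-1} & -2^{\frac m2-1} & 2^{\frac m2-2}\\ \pm2,\pm10 & 2^{\frac m2-3}-1 & -3\cdot2^{\frac m2-3} & 5\cdot2^{\frac m2-3} & -3\cdot2^{\frac m2-3}\\ \pm4 & -1 & 2^{\frac m2-2} & -3\cdot2^{\frac m2-2} & 2^{\frac m2-1} \end{array}$$ -/

import Mathlib

namespace KloostermanMod24

variable {F : Type*} [Field F] [Fintype F] [Algebra (ZMod 2) F]

/-- The canonical additive character `χ(x) = (-1)^{Tr(x)}` of a finite field `F` of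
characteristic 2, where `Tr : F → 𝔽₂` is the absolute trace. -/
noncomputable def chi (x : F) : ℤ :=
  (-1) ^ (Algebra.trace (ZMod 2) F x).val

/-- The Kloosterman sum `K(a) = ∑_{x ∈ F, x ≠ 0} χ(x + a x⁻¹)`, the sum running over the group of
nonzero elements of `F`. -/
noncomputable def kloosterman (a : F) : ℤ :=
  open Classical in ∑ x : Fˣ, chi ((x : F) + a * (x : F)⁻¹)

/-- `N(k)`: the number of nonzero `a ∈ F` with `K(a) ≡ k (mod 24)`. -/
noncomputable def count (F : Type*) [Field F] [Fintype F] [Algebra (ZMod 2) F] (k : ℤ) : ℕ :=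
  Nat.card {a : F // a ≠ 0 ∧ kloosterman a ≡ k [ZMOD 24]}

/-- The deviation `N(k) - 3 · 2^{m-4}`, a rational number, for a field `F` with `2^m` elements. -/
noncomputable def deviation (F : Type*) [Field F] [Fintype F] [Algebra (ZMod 2) F]
    (m : ℕ) (k : ℤ) : ℚ :=
  (count F k : ℚ) - 3 * (2 : ℚ) ^ ((m : ℤ) - 4)

/-- The power `2^{m/2 - j}` (used for even `m`), with an integer exponent. -/
def halfPow (m : ℕ) (j : ℤ) : ℚ :=
  (2 : ℚ) ^ (((m / 2 : ℕ) : ℤ) - j)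

end KloostermanMod24

namespace KloostermanMod24

open Polynomial
open scoped Classical

set_option linter.unusedSectionVars false

variable {F : Type*} [Field F] [Fintype F] [Algebra (ZMod 2) F] {n : ℕ}

/-! Write `m = 2n`. Modulo 8, `K(a)` is governed by `tr a`: the count of `x` with `tr x = tr (a/x) =
1` is `(q + K(a) + 1)/4`, and the involution `x ↦ a/x` gives its parity. Modulo 3, `q + 1 ± K(a)`
are the orders of the groups `y² + xy = x³ + δx² + a` with `tr δ = 0` and `tr δ = 1`. A point of
order 3 has `x⁴ + x³ = a`, and it is rational over `F` exactly when `tr x = tr δ`. Hence each `N(k)`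
is the size of the image under `f(x) = x⁴ + x³` of the set of `x` with `f(x) ≠ 0`, `tr x = i` and
`tr f(x) = j`, where `i` encodes `k` mod 3 and `j` encodes `k` mod 8 (`count_eq_card_image`).

The map `f` is injective away from the `x` for which `x + 1` is a cube. If `x = u³ + 1` then `f(x) =
(u⁴ + u)³`, whose fibre is `(u + e)³ + 1` with `e ∈ 𝔽₄`: four points when `u ∉ 𝔽₄`, all of the same
trace. So the image size follows from two trace counts, one over `x` and one over `u`
(`four_mul_card_image_quarticPairs`).

These counts reduce to the sums of `χ(x³)`, `χ(x³ + x)`, `χ(x⁹)` and `χ(x⁹ + x³)`. The sums without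
a linear term are quadratic and have square `q · |radical|`; being functions of `x³`, they are `1`
modulo 3, which fixes the sign. The sum of `χ(x³ + x)` comes from translation arguments. The
radicals depend on `3 ∣ n` and on `n` mod 4, whence the dependence on `m` mod 24. -/

/-! ### Trace, additive character and Artin–Schreier equations. -/

instance charP_two (F : Type*) [Field F] [Algebra (ZMod 2) F] : CharP F 2 :=
  charP_of_injective_algebraMap (algebraMap (ZMod 2) F).injective 2

theorem two_eq_zero : (2 : F) = 0 := by exact_mod_cast CharP.cast_eq_zero F 2

/-- The absolute trace to the prime field. -/
noncomputable abbrev tr (x : F) : ZMod 2 := Algebra.trace (ZMod 2) F x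

theorem tr_sq (x : F) : tr (x ^ 2) = tr x := by
  have := Algebra.trace_eq_of_algEquiv (FiniteField.frobeniusAlgEquiv (ZMod 2) F 2) x
  simpa [ZMod.card] using this

theorem tr_pow_two_pow (x : F) (n : ℕ) : tr (x ^ 2 ^ n) = tr x := by
  induction n with
  | zero => simp
  | succ n ih => rw [pow_succ, pow_mul, tr_sq, ih]

theorem zmod_two_cases (i : ZMod 2) : i = 0 ∨ i = 1 := by decide +revert

/-- The sign `(-1)^i`. -/
def sgn (i : ZMod 2) : ℤ := (-1) ^ i.val

theorem sgn_zero : sgn 0 = 1 := rfl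
theorem sgn_one : sgn 1 = -1 := rfl

theorem sgn_add (i j : ZMod 2) : sgn (i + j) = sgn i * sgn j := by decide +revert

theorem sgn_mul_self (i : ZMod 2) : sgn i * sgn i = 1 := by decide +revert

theorem chi_eq (x : F) : chi x = sgn (tr x) := rfl

theorem chi_zero : chi (0 : F) = 1 := by simp [chi_eq, tr, sgn_zero]

theorem chi_add (x y : F) : chi (x + y) = chi x * chi y := by
  simp only [chi_eq, tr, map_add, sgn_add]

theorem chi_mul_self (x : F) : chi x * chi x = 1 := sgn_mul_self _

theorem chi_congr {x y : F} (h : tr x = tr y) : chi x = chi y := by rw [chi_eq, chi_eq, h]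

theorem exists_tr_eq_one (F : Type*) [Field F] [Fintype F] [Algebra (ZMod 2) F] :
    ∃ x : F, tr x = 1 :=
  Algebra.trace_surjective (ZMod 2) F 1

theorem sum_chi : ∑ x : F, chi x = 0 := by
  obtain ⟨c, hc⟩ := exists_tr_eq_one F
  have h : ∑ x : F, chi (x + c) = ∑ x : F, chi x := Equiv.sum_comp (Equiv.addRight c) chi
  simp only [chi_add, ← Finset.sum_mul] at h
  rw [chi_eq c, hc, sgn_one] at h
  linarith

theorem sum_chi_mul {g : F → F} (hg : g.Bijective) (c : F) :
    ∑ x : F, chi (g x * c) = if c = 0 then (Fintype.card F : ℤ) else 0 := by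
  split_ifs with h
  · simp [h, chi_zero]
  · rw [← sum_chi (F := F)]
    exact ((Equiv.ofBijective g hg).trans (Equiv.mulRight₀ c h)).sum_comp chi

theorem add_sq_bijective : (fun x : F => x ^ 2).Bijective :=
  Finite.injective_iff_bijective.mp (frobenius_inj F 2)

theorem pow_two_pow_bijective (n : ℕ) : (fun x : F => x ^ 2 ^ n).Bijective :=
  Finite.injective_iff_bijective.mp (iterateFrobenius_inj F 2 n)

theorem tr_sq_add_self (y : F) : tr (y ^ 2 + y) = 0 := by
  rw [tr, map_add]
  exact (congrArg (· + tr y) (tr_sq y)).trans (CharTwo.add_self_eq_zero _)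

theorem card_artinSchreier_le (c : F) :
    ((Finset.univ.filter fun y : F => y ^ 2 + y = c).card : ℤ) ≤ 1 + chi c := by
  by_cases h : ∃ y : F, y ^ 2 + y = c
  · obtain ⟨y, rfl⟩ := h
    have hs : (Finset.univ.filter fun z : F => z ^ 2 + z = y ^ 2 + y) ⊆ {y, y + 1} := by
      intro z hz
      simp only [Finset.mem_filter, Finset.mem_univ, true_and] at hz
      have h2 := two_eq_zero (F := F)
      have : (z - y) * (z - (y + 1)) = 0 := by grind
      simpa [sub_eq_zero] using this
    have := (Finset.card_le_card hs).trans Finset.card_le_two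
    rw [chi_eq, tr_sq_add_self, sgn_zero]
    exact_mod_cast this
  · push Not at h
    rw [Finset.filter_false_of_mem fun y _ => h y, chi_eq]
    rcases zmod_two_cases (tr c) with hc | hc <;> simp [hc, sgn_zero, sgn_one]

/-- The number of solutions of an Artin-Schreier equation. -/
theorem card_artinSchreier (c : F) :
    ((Finset.univ.filter fun y : F => y ^ 2 + y = c).card : ℤ) = 1 + chi c := by
  have h := Finset.card_eq_sum_card_fiberwise (s := (Finset.univ : Finset F))
    (t := Finset.univ) (f := fun y : F => y ^ 2 + y) (fun _ _ => Finset.mem_univ _)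
  have h' : ∑ c : F, ((Finset.univ.filter fun y : F => y ^ 2 + y = c).card : ℤ) =
      ∑ c : F, (1 + chi c) := by
    rw [Finset.sum_add_distrib, sum_chi, add_zero, Finset.sum_const, nsmul_one]
    exact_mod_cast h.symm
  -- Both sides total `q` over all `c`, so the termwise inequality is an equality everywhere.
  exact (Finset.sum_eq_sum_iff_of_le fun c _ => card_artinSchreier_le c).mp h' c
    (Finset.mem_univ c)

theorem exists_artinSchreier {c : F} (hc : tr c = 0) : ∃ y : F, y ^ 2 + y = c := by
  have h := card_artinSchreier c
  rw [chi_eq, hc, sgn_zero] at h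
  obtain ⟨y, hy⟩ := Finset.card_pos.mp (by omega :
    0 < (Finset.univ.filter fun y : F => y ^ 2 + y = c).card)
  exact ⟨y, (Finset.mem_filter.mp hy).2⟩

/-! ### Kloosterman sums modulo 8. -/

theorem kloosterman_add_one (a : F) : kloosterman a + 1 = ∑ x : F, chi (x + a * x⁻¹) := by
  rw [← Finset.add_sum_erase _ _ (Finset.mem_univ (0 : F)), add_comm, kloosterman]
  congr 1
  · simp [chi_zero]
  · refine Finset.sum_bij (fun (u : Fˣ) _ => (u : F)) (by simp) (fun u _ v _ h => Units.ext h)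
      (fun x hx => ?_) (fun _ _ => rfl)
    exact ⟨Units.mk0 x (by simpa using hx), Finset.mem_univ _, rfl⟩

/-- The number of nonzero `x` such that both `x` and `a / x` have trace one. -/
noncomputable def oneOneCount (a : F) : ℕ :=
  (Finset.univ.filter fun x : F => tr x = 1 ∧ tr (a * x⁻¹) = 1).card

theorem four_mul_card_pair {α : Type*} [Fintype α] (f g : α → ZMod 2) (i j : ZMod 2) :
    4 * ((Finset.univ.filter fun x => f x = i ∧ g x = j).card : ℤ) =
      Fintype.card α + sgn i * ∑ x, sgn (f x) + sgn j * ∑ x, sgn (g x) +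
        sgn i * sgn j * ∑ x, sgn (f x) * sgn (g x) := by
  have h (x : α) : 4 * (if f x = i ∧ g x = j then (1 : ℤ) else 0) =
      1 + sgn i * sgn (f x) + sgn j * sgn (g x) + sgn i * sgn j * (sgn (f x) * sgn (g x)) := by
    generalize f x = k
    generalize g x = l
    revert i j k l
    decide
  rw [Finset.card_filter]
  push_cast
  rw [Finset.mul_sum, Finset.sum_congr rfl fun x _ => h x]
  simp only [Finset.sum_add_distrib, ← Finset.mul_sum]
  simp

theorem mul_inv_bijective {a : F} (ha : a ≠ 0) : (fun x : F => a * x⁻¹).Bijective :=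
  Finite.injective_iff_bijective.mp fun _ _ h => inv_injective (mul_left_cancel₀ ha h)

theorem four_mul_oneOneCount {a : F} (ha : a ≠ 0) :
    4 * (oneOneCount a : ℤ) = Fintype.card F + kloosterman a + 1 := by
  rw [oneOneCount, four_mul_card_pair (fun x : F => tr x) (fun x => tr (a * x⁻¹)) 1 1,
    add_assoc _ (kloosterman a), kloosterman_add_one]
  have h1 : ∑ x : F, sgn (tr x) = 0 := sum_chi
  have h2 : ∑ x : F, sgn (tr (a * x⁻¹)) = 0 :=
    ((Equiv.ofBijective _ (mul_inv_bijective ha)).sum_comp chi).trans sum_chi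
  rw [h1, h2]
  simp only [sgn_one, ← chi_eq, ← chi_add]
  ring

/-- The involution `x ↦ a/x` preserves the counted set, and its only possible fixed point is `b =
√a`, which is counted exactly when `tr b = tr a` equals 1. -/
theorem oneOneCount_parity {a : F} (ha : a ≠ 0) : (oneOneCount a : ZMod 2) = tr a := by
  obtain ⟨b, rfl⟩ := add_sq_bijective.surjective a
  have hb : b ≠ 0 := by rintro rfl; simp at ha
  have hmem (x : F) (hx : tr x = 1) : x ≠ 0 := by rintro rfl; simp [tr] at hx
  set s := Finset.univ.filter fun x : F => tr x = 1 ∧ tr (b ^ 2 * x⁻¹) = 1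
  have hsum : ∑ x ∈ s.erase b, (1 : ZMod 2) = 0 := by
    refine Finset.sum_involution (fun x _ => b ^ 2 * x⁻¹) (fun _ _ => rfl) ?_ ?_ ?_
    · intro x hx _ h
      obtain ⟨hxb, hx⟩ := Finset.mem_erase.mp hx
      have hx0 := hmem x (Finset.mem_filter.mp hx).2.1
      have h2 := two_eq_zero (F := F)
      have h' : b ^ 2 = x ^ 2 := by field_simp at h; exact h
      exact hxb (add_sq_bijective.injective h').symm
    · intro x hx
      obtain ⟨hxb, hx⟩ := Finset.mem_erase.mp hx
      have hx' := (Finset.mem_filter.mp hx).2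
      have hx0 := hmem x hx'.1
      refine Finset.mem_erase.mpr ⟨fun h => hxb ?_, Finset.mem_filter.mpr
        ⟨Finset.mem_univ _, hx'.2, ?_⟩⟩
      · field_simp at h
        exact h.symm
      · convert! hx'.1 using 2
        field_simp
    · intro x hx
      have hx0 := hmem x (Finset.mem_filter.mp (Finset.mem_erase.mp hx).2).2.1
      field_simp
  have hbt : tr (b ^ 2 * b⁻¹) = tr b := by congr 1; field_simp
  simp only [Finset.sum_const, nsmul_one] at hsum
  rw [oneOneCount, tr_sq]
  rcases zmod_two_cases (tr b) with h | h
  · rw [Finset.erase_eq_of_notMem (by simp [s, h])] at hsum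
    rw [h, hsum]
  · have hb : b ∈ s := by simp [s, hbt, h]
    rw [h, ← Finset.card_erase_add_one hb, Nat.cast_add, hsum]
    simp

/-- The residue modulo `8` of a Kloosterman sum is determined by the trace. -/
theorem kloosterman_mod_eight {a : F} (ha : a ≠ 0) (hq : 8 ∣ Fintype.card F) :
    kloosterman a % 8 = if tr a = 0 then 7 else 3 := by
  have h1 := four_mul_oneOneCount ha
  have h2 := oneOneCount_parity ha
  split_ifs with h
  · rw [h, ZMod.natCast_eq_zero_iff] at h2
    omega
  · rw [(zmod_two_cases (tr a)).resolve_left h] at h2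
    have : ¬ 2 ∣ oneOneCount a := by
      rw [← ZMod.natCast_eq_zero_iff, h2]
      exact one_ne_zero
    omega

/-! ### Kloosterman sums modulo 3 through 3-torsion of elliptic curves. -/

/-- Frobenius invariance of the trace, used twice with `a = b²`: it turns `b²x⁻²` into `bx⁻¹`, and
then the substitution `x ↦ x²` returns to `b²`. The left-hand sum is the one met when counting
points of `curve δ a`. -/
theorem kloosterman_sq_sum (a : F) :
    ∑ x : F, chi (x + a * (x⁻¹) ^ 2) = kloosterman a + 1 := by
  obtain ⟨b, rfl⟩ := add_sq_bijective.surjective a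
  have h1 (x : F) : chi (x + b ^ 2 * (x⁻¹) ^ 2) = chi (x + b * x⁻¹) := by
    rw [chi_add, chi_add x, ← mul_pow]
    congr 1
    exact chi_congr (tr_sq _)
  have h2 (x : F) : chi (x + b * x⁻¹) = chi (x ^ 2 + b ^ 2 * (x ^ 2)⁻¹) := by
    refine chi_congr ?_
    rw [← tr_sq]
    have h2 := two_eq_zero (F := F)
    congr 1
    rw [← inv_pow]
    grind
  rw [kloosterman_add_one, Finset.sum_congr rfl fun x _ => (h1 x).trans (h2 x)]
  exact (Equiv.ofBijective _ add_sq_bijective).sum_comp fun x : F => chi (x + b ^ 2 * x⁻¹)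

/-- The ordinary elliptic curve `y² + xy = x³ + δx² + a` in characteristic two. -/
def curve (δ a : F) : WeierstrassCurve.Affine F := ⟨1, δ, 0, 0, a⟩

theorem curve_equation_iff (δ a x y : F) :
    (curve δ a).Equation x y ↔ y ^ 2 + x * y = x ^ 3 + δ * x ^ 2 + a := by
  rw [WeierstrassCurve.Affine.equation_iff]
  simp [curve]

theorem curve_nonsingular_iff {δ a : F} (ha : a ≠ 0) (x y : F) :
    (curve δ a).Nonsingular x y ↔ y ^ 2 + x * y = x ^ 3 + δ * x ^ 2 + a := by
  rw [← curve_equation_iff, WeierstrassCurve.Affine.equation_iff_nonsingular_of_Δ_ne_zero]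
  have h2 := two_eq_zero (F := F)
  have : (curve δ a).Δ = a := by
    simp only [WeierstrassCurve.Δ, WeierstrassCurve.b₂, WeierstrassCurve.b₄, WeierstrassCurve.b₆,
      WeierstrassCurve.b₈, curve]
    grind
  rwa [this]

/-- For `x ≠ 0`, setting `y = xz` gives the Artin–Schreier equation `z² + z = x + δ + a/x²`; for `x
= 0` the only solution is `y = √a`. -/
theorem card_curve_fiber (δ a x : F) :
    ((Finset.univ.filter fun y : F => y ^ 2 + x * y = x ^ 3 + δ * x ^ 2 + a).card : ℤ) =
      if x = 0 then 1 else 1 + chi δ * chi (x + a * (x⁻¹) ^ 2) := by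
  split_ifs with hx
  · obtain ⟨b, rfl⟩ := add_sq_bijective.surjective a
    have : (Finset.univ.filter fun y : F => y ^ 2 + x * y = x ^ 3 + δ * x ^ 2 + b ^ 2) = {b} := by
      ext y
      simp only [hx, Finset.mem_filter, Finset.mem_univ, true_and, Finset.mem_singleton]
      constructor
      · intro h
        exact add_sq_bijective.injective (by simpa using h)
      · rintro rfl
        simp
    simp [this]
  · rw [← chi_add, ← card_artinSchreier]
    norm_cast
    refine Finset.card_equiv (Equiv.mulRight₀ x⁻¹ (inv_ne_zero hx)) fun y => ?_
    simp only [Finset.mem_filter, Finset.mem_univ, true_and, Equiv.mulRight₀_apply]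
    constructor <;> intro h
    · field_simp
      linear_combination h
    · field_simp at h
      linear_combination h

/-- The points of `curve δ a` as solutions of the equation and one point at infinity. -/
noncomputable def curvePointEquiv (δ a : F) :
    (curve δ a).Point ≃ Option {p : F × F // (curve δ a).Nonsingular p.1 p.2} :=
  WeierstrassCurve.Affine.nonsingularPointEquiv (curve δ a)

noncomputable instance curvePointFintype (δ a : F) : Fintype (curve δ a).Point :=
  Fintype.ofEquiv _ (curvePointEquiv δ a).symm

theorem card_curve {a : F} (ha : a ≠ 0) (δ : F) :
    (Fintype.card (curve δ a).Point : ℤ) = Fintype.card F + 1 + chi δ * kloosterman a := by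
  have h1 : Fintype.card (curve δ a).Point =
      (Finset.univ.filter fun p : F × F =>
        p.2 ^ 2 + p.1 * p.2 = p.1 ^ 3 + δ * p.1 ^ 2 + a).card + 1 := by
    rw [Fintype.card_congr (curvePointEquiv δ a),
      Fintype.card_option, Fintype.card_subtype]
    simp only [curve_nonsingular_iff ha]
  have h2 : ((Finset.univ.filter fun p : F × F =>
        p.2 ^ 2 + p.1 * p.2 = p.1 ^ 3 + δ * p.1 ^ 2 + a).card : ℤ) = ∑ x : F,
      ((Finset.univ.filter fun y : F => y ^ 2 + x * y = x ^ 3 + δ * x ^ 2 + a).card : ℤ) := by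
    simp only [Finset.card_filter, Fintype.sum_prod_type]
    push_cast
    rfl
  -- Since `0⁻¹ = 0`, the general formula at `x = 0` would give `1 + χ(δ)`. The excess `χ(δ)` later
  -- cancels the `+ 1` of `kloosterman_sq_sum`.
  have h3 : (∑ x : F, if x = 0 then 1 else 1 + chi δ * chi (x + a * (x⁻¹) ^ 2)) =
      ∑ x : F, (1 + chi δ * chi (x + a * (x⁻¹) ^ 2)) - chi δ := by
    rw [eq_sub_iff_add_eq, ← Finset.sum_erase_add _ _ (Finset.mem_univ (0 : F)),
      ← Finset.sum_erase_add (a := (0 : F)) _ (fun x => 1 + chi δ * chi (x + a * (x⁻¹) ^ 2))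
        (Finset.mem_univ _), Finset.sum_congr rfl fun x hx => if_neg (Finset.mem_erase.mp hx).1]
    simp [chi_zero, add_assoc]
  rw [h1, Nat.cast_add, h2, Finset.sum_congr rfl fun x _ => card_curve_fiber δ a x, h3,
    Finset.sum_add_distrib, ← Finset.mul_sum, kloosterman_sq_sum]
  simp
  ring

/-- The duplication formula is `X(2P) = (x⁴ + a)/x²`, so `X(2P) = X(P)` amounts to `x⁴ + x³ = a`.
Equal abscissae leave `2P = ±P`, and `2P = P` is impossible for an affine point. Points with `x = 0`
are 2-torsion. -/
theorem curve_add_self_eq_neg_iff {δ a x y : F} (h : (curve δ a).Nonsingular x y) (ha : a ≠ 0) :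
    (.some x y h : (curve δ a).Point) + .some x y h = -.some x y h ↔
      x ≠ 0 ∧ x ^ 4 + x ^ 3 = a := by
  have h2 := two_eq_zero (F := F)
  have heq := (curve_nonsingular_iff ha x y).mp h
  have hneg : (curve δ a).negY x y = y + x := by
    simp only [WeierstrassCurve.Affine.negY, curve]
    grind
  rcases eq_or_ne x 0 with hx | hx
  · have hy : y = (curve δ a).negY x y := by rw [hneg, hx, add_zero]
    rw [WeierstrassCurve.Affine.Point.add_self_of_Y_eq hy]
    simp [hx, WeierstrassCurve.Affine.Point.neg_some, WeierstrassCurve.Affine.Point.zero_def]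
  · have hy : y ≠ (curve δ a).negY x y := by
      rw [hneg]
      simpa using hx
    have hX : (curve δ a).addX x x ((curve δ a).slope x x y y) = x ↔ x ^ 4 + x ^ 3 = a := by
      rw [WeierstrassCurve.Affine.slope_of_Y_ne rfl hy, hneg]
      have : (curve δ a).addX x x ((3 * x ^ 2 + 2 * (curve δ a).a₂ * x + (curve δ a).a₄ -
          (curve δ a).a₁ * y) / (y - (y + x))) = (x ^ 4 + a) / x ^ 2 := by
        have hd : y - (y + x) = x := by grind
        simp only [WeierstrassCurve.Affine.addX, curve, hd]
        field_simp
        grind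
      rw [this]
      field_simp
      grind
    rw [← hX, WeierstrassCurve.Affine.Point.add_self_of_Y_ne hy]
    constructor
    · intro h'
      rw [WeierstrassCurve.Affine.Point.neg_some, WeierstrassCurve.Affine.Point.some.injEq] at h'
      exact ⟨hx, h'.1⟩
    · rintro ⟨-, h'⟩
      rcases (WeierstrassCurve.Affine.Point.X_eq_iff (h₂ := h)
        (h₁ := WeierstrassCurve.Affine.nonsingular_add h h fun hxy => hy hxy.2)).mp h' with
        h'' | h''
      · rw [← WeierstrassCurve.Affine.Point.add_self_of_Y_ne (h₁ := h) hy, add_eq_left] at h''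
        exact absurd h'' (WeierstrassCurve.Affine.Point.some_ne_zero h)
      · exact h''

theorem exists_curve_point_iff {a x : F} (δ : F) (hx : x ≠ 0) (h : x ^ 4 + x ^ 3 = a) :
    (∃ y, y ^ 2 + x * y = x ^ 3 + δ * x ^ 2 + a) ↔ tr x = tr δ := by
  have h2 := two_eq_zero (F := F)
  have key (y : F) : y ^ 2 + x * y = x ^ 3 + δ * x ^ 2 + a ↔ (y / x) ^ 2 + y / x = x ^ 2 + δ := by
    rw [← h]
    field_simp
    grind
  have ht : tr (x ^ 2 + δ) = 0 ↔ tr x = tr δ := by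
    rw [tr, map_add, ← tr, tr_sq]
    exact CharTwo.add_eq_zero
  rw [← ht]
  constructor
  · rintro ⟨y, hy⟩
    rw [← (key y).mp hy, tr_sq_add_self]
  · intro h
    obtain ⟨z, hz⟩ := exists_artinSchreier h
    exact ⟨z * x, (key _).mpr (by rwa [mul_div_cancel_right₀ _ hx])⟩

theorem three_dvd_card_curve_iff {a : F} (ha : a ≠ 0) (δ : F) :
    3 ∣ Fintype.card (curve δ a).Point ↔ ∃ x : F, x ^ 4 + x ^ 3 = a ∧ tr x = tr δ := by
  constructor
  · intro h
    have : Fact (Nat.Prime 3) := ⟨Nat.prime_three⟩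
    obtain ⟨P, hP⟩ := exists_prime_addOrderOf_dvd_card 3 h
    have h3 : 3 • P = 0 := hP ▸ addOrderOf_nsmul_eq_zero P
    have hn : P + P = -P := by
      rw [← add_eq_zero_iff_eq_neg, ← h3]
      abel
    cases P with
    | zero => simp [← WeierstrassCurve.Affine.Point.zero_def] at hP
    | some x y hxy =>
      obtain ⟨hx, hx'⟩ := (curve_add_self_eq_neg_iff hxy ha).mp hn
      exact ⟨x, hx', (exists_curve_point_iff δ hx hx').mp
        ⟨y, (curve_nonsingular_iff ha x y).mp hxy⟩⟩
  · rintro ⟨x, hx', hxt⟩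
    have hx : x ≠ 0 := by
      rintro rfl
      simp at hx'
      exact ha hx'.symm
    obtain ⟨y, hy⟩ := (exists_curve_point_iff δ hx hx').mpr hxt
    have hns := (curve_nonsingular_iff ha x y).mpr hy
    have hn := (curve_add_self_eq_neg_iff hns ha).mpr ⟨hx, hx'⟩
    rw [← add_eq_zero_iff_eq_neg] at hn
    have : addOrderOf (.some x y hns : (curve δ a).Point) = 3 := by
      have : Fact (Nat.Prime 3) := ⟨Nat.prime_three⟩
      refine addOrderOf_eq_prime ?_ (WeierstrassCurve.Affine.Point.some_ne_zero hns)
      rw [← hn]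
      abel
    rw [← this]
    exact addOrderOf_dvd_card

/-- The residue modulo `3` of a Kloosterman sum over a field with `q ≡ 1 (mod 3)` elements. -/
theorem kloosterman_mod_three {a : F} (ha : a ≠ 0) (hq : Fintype.card F % 3 = 1) :
    (kloosterman a % 3 = 1 ↔ ∃ x : F, x ^ 4 + x ^ 3 = a ∧ tr x = 0) ∧
      (kloosterman a % 3 = 2 ↔ ∃ x : F, x ^ 4 + x ^ 3 = a ∧ tr x = 1) := by
  obtain ⟨δ, hδ⟩ := exists_tr_eq_one F
  have h0 := three_dvd_card_curve_iff ha 0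
  have h1 := three_dvd_card_curve_iff ha δ
  have c0 := card_curve ha 0
  have c1 := card_curve ha δ
  rw [chi_zero] at c0
  rw [chi_eq, hδ, sgn_one] at c1
  rw [tr, map_zero] at h0
  rw [hδ] at h1
  rw [← h0, ← h1]
  -- As `q + 1 ≡ 2 (mod 3)`, the two group orders are `2 + K(a)` and `2 - K(a)` modulo 3.
  omega

/-! ### Quadratic exponential sums. -/

/-- Expanding the square and summing over `x` first leaves only the `y` in the radical `L y = 0`.
There `φ y = 1`, because translation by `y` multiplies the nonzero sum by `φ y`. -/
theorem quadratic_sum_sq {φ : F → ℤ} {g L : F → F} (hg : g.Bijective)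
    (hφ : ∀ x y, φ (x + y) = φ x * φ y * chi (g x * L y)) (hu : ∀ x, φ x * φ x = 1)
    (hS : ∑ x, φ x ≠ 0) :
    (∑ x, φ x) ^ 2 = Fintype.card F * (Finset.univ.filter fun y => L y = 0).card := by
  have hrad (y : F) (hy : L y = 0) : φ y = 1 := by
    have h : ∑ x, φ (x + y) = ∑ x, φ x := Equiv.sum_comp (Equiv.addRight y) φ
    simp only [hφ, hy, mul_zero, chi_zero, mul_one, ← Finset.sum_mul] at h
    exact mul_left_cancel₀ hS (h.trans (mul_one _).symm)
  have h1 (x : F) : φ x * ∑ y, φ y = ∑ y, φ y * chi (g x * L y) := by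
    rw [← Equiv.sum_comp (Equiv.addLeft x) φ, Finset.mul_sum]
    refine Finset.sum_congr rfl fun y _ => ?_
    rw [Equiv.coe_addLeft, hφ, ← mul_assoc, ← mul_assoc, hu, one_mul]
  rw [sq, Finset.sum_mul, Finset.sum_congr rfl fun x _ => h1 x, Finset.sum_comm]
  simp only [← Finset.mul_sum, sum_chi_mul hg]
  rw [Finset.card_filter]
  push_cast
  rw [Finset.mul_sum]
  refine Finset.sum_congr rfl fun y _ => ?_
  split_ifs with hy
  · rw [hrad y hy, one_mul, mul_one]
  · rw [mul_zero, mul_zero]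

theorem eq_neg_two_pow {S : ℤ} {e : ℕ} (h : S ^ 2 = 2 ^ (2 * e)) (h3 : S % 3 = 1) :
    S = (-2) ^ e := by
  have h4 : S ^ 2 = ((-2) ^ e) ^ 2 := by rw [h, ← pow_mul, mul_comm e, pow_mul, pow_mul]; norm_num
  rcases sq_eq_sq_iff_eq_or_eq_neg.mp h4 with h | h
  · exact h
  · have h5 : (-2 : ℤ) ^ e % 3 = 1 := by
      have : (-2 : ℤ) ^ e ≡ 1 ^ e [ZMOD 3] := Int.ModEq.pow e (by decide)
      rwa [one_pow] at this
    omega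

theorem exists_cube_root_of_unity (h1 : tr (1 : F) = 0) : ∃ w : F, w ^ 2 + w = 1 :=
  exists_artinSchreier h1

theorem cube_eq_cube_iff {w x y : F} (hw : w ^ 2 + w = 1) :
    y ^ 3 = x ^ 3 ↔ y = x ∨ y = w * x ∨ y = (w + 1) * x := by
  have h2 := two_eq_zero (F := F)
  have : y ^ 3 - x ^ 3 = (y - x) * ((y - w * x) * (y - (w + 1) * x)) := by grind
  rw [← sub_eq_zero, this, mul_eq_zero, mul_eq_zero]
  simp only [sub_eq_zero]

theorem card_cube_fiber {w x : F} (hw : w ^ 2 + w = 1) (hx : x ≠ 0) :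
    (Finset.univ.filter fun y : F => y ^ 3 = x ^ 3).card = 3 := by
  have h2 := two_eq_zero (F := F)
  have h0 : w ≠ 0 := by rintro rfl; simp at hw
  have h1 : w ≠ 1 := by rintro rfl; simp [CharTwo.add_self_eq_zero] at hw
  have : (Finset.univ.filter fun y : F => y ^ 3 = x ^ 3) = {x, w * x, (w + 1) * x} := by
    ext y
    simp [cube_eq_cube_iff hw]
  rw [this, Finset.card_eq_three]
  exact ⟨_, _, _, by simpa [hx, eq_comm] using h1,
    by simp [hx, h0, eq_comm], by simp [hx], rfl⟩

/-- Each nonzero cube has exactly three cube roots, so modulo 3 only the term at `0` survives. -/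
theorem sum_cube_mod_three {w : F} (hw : w ^ 2 + w = 1) (ψ : F → ℤ) (h0 : ψ 0 = 1) :
    (∑ x, ψ (x ^ 3)) % 3 = 1 := by
  have h : (3 : ℤ) ∣ ∑ x ∈ Finset.univ.erase (0 : F), ψ (x ^ 3) := by
    rw [Finset.sum_comp ψ fun x : F => x ^ 3]
    refine Finset.dvd_sum fun b hb => ?_
    obtain ⟨x, hx, rfl⟩ := Finset.mem_image.mp hb
    have hx0 := (Finset.mem_erase.mp hx).1
    have : ((Finset.univ.erase (0 : F)).filter fun y => y ^ 3 = x ^ 3) =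
        Finset.univ.filter fun y : F => y ^ 3 = x ^ 3 := by
      ext y
      simp only [Finset.mem_filter, Finset.mem_erase, Finset.mem_univ, true_and, and_true,
        and_iff_right_iff_imp]
      rintro h rfl
      exact hx0 (by simpa using h.symm)
    rw [this, card_cube_fiber hw hx0]
    exact ⟨_, nsmul_eq_mul _ _⟩
  rw [← Finset.add_sum_erase _ _ (Finset.mem_univ (0 : F)), zero_pow three_ne_zero, h0]
  omega

theorem card_pow_eq_self {m k : ℕ} (hq : Fintype.card F = 2 ^ m) :
    (Finset.univ.filter fun y : F => y ^ 2 ^ k = y).card = 2 ^ m.gcd k := by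
  have hker : Nat.card (powMonoidHom (2 ^ k - 1) : Fˣ →* Fˣ).ker = 2 ^ m.gcd k - 1 := by
    rw [IsCyclic.card_powMonoidHom_ker, Nat.card_units, Nat.card_eq_fintype_card, hq,
      Nat.pow_sub_one_gcd_pow_sub_one]
  have hs : (Finset.univ.filter fun y : F => y ^ 2 ^ k = y).erase 0 =
      (Finset.univ.filter fun u : Fˣ => u ^ (2 ^ k - 1) = 1).map
        ⟨Units.val, Units.val_injective⟩ := by
    have hpow (y : F) : y ^ 2 ^ k = y ^ (2 ^ k - 1) * y := by
      rw [← pow_succ, Nat.sub_add_cancel Nat.one_le_two_pow]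
    ext y
    simp only [Finset.mem_erase, Finset.mem_filter, Finset.mem_univ, true_and, Finset.mem_map,
      Function.Embedding.coeFn_mk]
    constructor
    · rintro ⟨hy, h⟩
      refine ⟨Units.mk0 y hy, ?_, rfl⟩
      ext
      exact mul_right_cancel₀ hy (by simpa [← hpow] using h)
    · rintro ⟨u, hu, rfl⟩
      refine ⟨u.ne_zero, ?_⟩
      rw [hpow, ← Units.val_pow_eq_pow_val, hu, Units.val_one, one_mul]
  have h0 : (0 : F) ∈ Finset.univ.filter fun y : F => y ^ 2 ^ k = y := by simp
  rw [← Finset.card_erase_add_one h0, hs, Finset.card_map, ← Nat.sub_add_cancel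
    (Nat.one_le_two_pow (n := m.gcd k)), ← hker, Nat.card_eq_fintype_card, Fintype.card_subtype]
  congr 2
  ext u
  simp [MonoidHom.mem_ker]

/-- The Frobenius-fixed elements of order `k` only depend on `gcd m k`. -/
theorem pow_eq_self_of_gcd_eq {m k l : ℕ} (hq : Fintype.card F = 2 ^ m) (hkl : k ∣ l)
    (h : m.gcd k = m.gcd l) {y : F} (hy : y ^ 2 ^ l = y) :
    y ^ 2 ^ k = y := by
  have hs : (Finset.univ.filter fun y : F => y ^ 2 ^ k = y) ⊆
      Finset.univ.filter fun y : F => y ^ 2 ^ l = y := by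
    intro z hz
    simp only [Finset.mem_filter, Finset.mem_univ, true_and] at hz ⊢
    obtain ⟨n, rfl⟩ := hkl
    clear h hy
    induction n with
    | zero => simp
    | succ n ih => rw [mul_add_one, pow_add, pow_mul, ih, hz]
  have := Finset.eq_of_subset_of_card_le hs
    (by rw [card_pow_eq_self hq, card_pow_eq_self hq, h])
  have hy' : y ∈ Finset.univ.filter fun y : F => y ^ 2 ^ l = y := by simpa using hy
  rw [← this] at hy'
  simpa using hy'

theorem tr_one {m : ℕ} (hq : Fintype.card F = 2 ^ m) : tr (1 : F) = m := by
  have h := Algebra.trace_algebraMap (R := ZMod 2) (S := F) 1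
  rw [map_one, nsmul_one] at h
  rw [tr, h]
  have := Module.card_eq_pow_finrank (K := ZMod 2) (V := F)
  rw [hq, ZMod.card] at this
  rw [Nat.pow_right_injective le_rfl this]

theorem tr_one_eq_zero {n : ℕ} (hq : Fintype.card F = 2 ^ (2 * n)) : tr (1 : F) = 0 := by
  rw [tr_one hq, Nat.cast_mul]
  exact (congrArg (· * (n : ZMod 2)) (two_eq_zero (F := ZMod 2))).trans (zero_mul _)

theorem chi_pow_two_pow (x : F) (n : ℕ) : chi (x ^ 2 ^ n) = chi x := chi_congr (tr_pow_two_pow x n)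

/-- In the cross term `xy² + x²y`, squaring the first summand preserves its trace and makes the form
linear in `x²`: `x²(y⁴ + y)`. The radical is thus `𝔽₄`. -/
theorem chi_cube_add (x y : F) :
    chi ((x + y) ^ 3) = chi (x ^ 3) * chi (y ^ 3) * chi (x ^ 2 ^ 1 * (y ^ 2 ^ 2 + y)) := by
  have h2 := two_eq_zero (F := F)
  have h1 : (x + y) ^ 3 = x ^ 3 + y ^ 3 + (x * y ^ 2 + x ^ 2 * y) := by grind
  rw [h1, chi_add, chi_add, chi_add (x * y ^ 2), ← chi_pow_two_pow (x * y ^ 2) 1, mul_pow, ← pow_mul]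
  norm_num only
  rw [mul_add, chi_add (x ^ 2 * y ^ 4)]

theorem chi_ninth_add (x y : F) :
    chi ((x + y) ^ 9) = chi (x ^ 9) * chi (y ^ 9) * chi (x ^ 2 ^ 3 * (y ^ 2 ^ 6 + y)) := by
  have h2 := two_eq_zero (F := F)
  have h1 : (x + y) ^ 9 = x ^ 9 + y ^ 9 + (x * y ^ 8 + x ^ 8 * y) := by grind
  rw [h1, chi_add, chi_add, chi_add (x * y ^ 8), ← chi_pow_two_pow (x * y ^ 8) 3, mul_pow, ← pow_mul]
  norm_num only
  rw [mul_add, chi_add (x ^ 8 * y ^ 64)]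

theorem chi_ninth_cube_add (x y : F) :
    chi ((x + y) ^ 9 + (x + y) ^ 3) = chi (x ^ 9 + x ^ 3) * chi (y ^ 9 + y ^ 3) *
      chi (x ^ 2 ^ 3 * (y ^ 64 + y ^ 16 + y ^ 4 + y)) := by
  have h : x ^ 2 ^ 3 * (y ^ 64 + y ^ 16 + y ^ 4 + y) =
      x ^ 2 ^ 3 * (y ^ 2 ^ 6 + y) + (x ^ 2 ^ 1 * (y ^ 2 ^ 2 + y)) ^ 2 ^ 2 := by
    have h2 := two_eq_zero (F := F)
    grind
  rw [h, chi_add _ (_ ^ 2 ^ 2), chi_pow_two_pow, chi_add ((x + y) ^ 9), chi_ninth_add,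
    chi_cube_add, chi_add (x ^ 9), chi_add (y ^ 9)]
  ring

theorem sum_chi_cube_poly {p : F → F} (hq : Fintype.card F = 2 ^ (2 * n)) (h0 : p 0 = 0) :
    (∑ x : F, chi (p (x ^ 3))) % 3 = 1 := by
  obtain ⟨w, hw⟩ := exists_cube_root_of_unity (tr_one_eq_zero hq)
  exact sum_cube_mod_three hw (fun x => chi (p x)) (by rw [h0, chi_zero])

/-- A quadratic exponential sum that is `1` modulo `3` is determined by the size of its radical. -/
theorem quadratic_sum_eq {f g L : F → F} {k : ℕ} (hq : Fintype.card F = 2 ^ (2 * n))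
    (hg : g.Bijective) (hf : ∀ x y, chi (f (x + y)) = chi (f x) * chi (f y) * chi (g x * L y))
    (h3 : (∑ x : F, chi (f x)) % 3 = 1)
    (hL : (Finset.univ.filter fun y => L y = 0).card = 2 ^ (2 * k)) :
    ∑ x : F, chi (f x) = (-2) ^ (n + k) := by
  refine eq_neg_two_pow ?_ h3
  rw [quadratic_sum_sq hg hf (fun x => chi_mul_self _) (by rintro h; simp [h] at h3), hL, hq]
  push_cast
  ring

theorem card_pow_add_self_eq_zero {m k : ℕ} (hq : Fintype.card F = 2 ^ m) :
    (Finset.univ.filter fun y : F => y ^ 2 ^ k + y = 0).card = 2 ^ m.gcd k := by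
  rw [← card_pow_eq_self hq]
  simp only [CharTwo.add_eq_zero]

theorem sum_chi_cube (hq : Fintype.card F = 2 ^ (2 * n)) :
    ∑ x : F, chi (x ^ 3) = (-2) ^ (n + 1) := by
  refine quadratic_sum_eq (L := fun y => y ^ 2 ^ 2 + y) hq (pow_two_pow_bijective 1) chi_cube_add
    (sum_chi_cube_poly (p := id) hq rfl) ?_
  rw [card_pow_add_self_eq_zero hq, Nat.gcd_mul_right_left]

theorem sum_chi_ninth (hq : Fintype.card F = 2 ^ (2 * n)) :
    ∑ x : F, chi (x ^ 9) = (-2) ^ (n + if 3 ∣ n then 3 else 1) := by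
  have h9 (x : F) : x ^ 9 = (x ^ 3) ^ 3 := by rw [← pow_mul]
  have h3 : (∑ x : F, chi (x ^ 9)) % 3 = 1 := by
    simp only [h9]
    exact sum_chi_cube_poly (p := fun x => x ^ 3) hq (by simp)
  refine quadratic_sum_eq hq (pow_two_pow_bijective 3) chi_ninth_add h3 ?_
  rw [card_pow_add_self_eq_zero hq, show 6 = 2 * 3 from rfl, Nat.gcd_mul_left]
  split_ifs with h
  · rw [Nat.gcd_eq_right h]
  · rw [((Nat.Prime.coprime_iff_not_dvd Nat.prime_three).mpr h).symm]

/-- `R(y) = y⁶⁴ + y¹⁶ + y⁴ + y` satisfies `R⁴ + R = y²⁵⁶ + y`, so its zeros lie in `F ∩ 𝔽₂₅₆`. If `4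
∣ n`, this is `𝔽₂₅₆`, which the additive map `R` sends into `𝔽₄`; hence there are at least 64 zeros,
and the degree allows no more. Otherwise the intersection is `𝔽₁₆` or `𝔽₄`, and `R` vanishes on it.
-/
theorem card_radical (hq : Fintype.card F = 2 ^ (2 * n)) :
    (Finset.univ.filter fun y : F => y ^ 64 + y ^ 16 + y ^ 4 + y = 0).card =
      2 ^ (2 * if n % 4 = 0 then 3 else if n % 2 = 0 then 2 else 1) := by
  have h2 := two_eq_zero (F := F)
  have hR (y : F) : (y ^ 64 + y ^ 16 + y ^ 4 + y) ^ 4 + (y ^ 64 + y ^ 16 + y ^ 4 + y) =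
      y ^ 2 ^ 8 + y := by
    have h4 (a b : F) : (a + b) ^ 4 = a ^ 4 + b ^ 4 := by grind
    simp only [h4, ← pow_mul]
    grind
  have hR' {y : F} (hy : y ^ 64 + y ^ 16 + y ^ 4 + y = 0) : y ^ 2 ^ 8 = y := by
    have := hR y
    rw [hy, zero_pow four_ne_zero, zero_add] at this
    exact CharTwo.add_eq_zero.mp this.symm
  have hgcd : n.gcd 4 = (n % 4).gcd 4 := by rw [Nat.gcd_comm, Nat.gcd_rec]
  have hg8 : (2 * n).gcd 8 = 2 * (n % 4).gcd 4 := by rw [← hgcd, ← Nat.gcd_mul_left]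
  have hk8 (k : ℕ) (hk : n % 4 = k) : (2 * n).gcd 8 = 2 * k.gcd 4 := hk ▸ hg8
  have hadd (x y : F) : (x + y) ^ 64 + (x + y) ^ 16 + (x + y) ^ 4 + (x + y) =
      (x ^ 64 + x ^ 16 + x ^ 4 + x) + (y ^ 64 + y ^ 16 + y ^ 4 + y) := by
    have h6 := add_pow_char_pow (p := 2) (n := 6) x y
    have h4 := add_pow_char_pow (p := 2) (n := 4) x y
    have h1 := add_pow_char_pow (p := 2) (n := 2) x y
    norm_num only at h6 h4 h1
    rw [h6, h4, h1]
    ring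
  split_ifs with h4 h2
  · have hcard : (Finset.univ.filter fun y : F => y ^ 2 ^ 8 = y).card = 256 := by
      rw [card_pow_eq_self hq, hk8 0 h4]
      rfl
    have hcard' : (Finset.univ.filter fun y : F => y ^ 2 ^ 2 = y).card = 4 := by
      rw [card_pow_eq_self hq, Nat.gcd_mul_right_left]
      rfl
    refine le_antisymm ?_ ?_
    · have hdeg : (X ^ 64 + X ^ 16 + X ^ 4 + X : F[X]).natDegree = 64 := by compute_degree!
      have hne : (X ^ 64 + X ^ 16 + X ^ 4 + X : F[X]) ≠ 0 := by
        intro h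
        rw [h] at hdeg
        simp at hdeg
      refine le_trans (Finset.card_le_card (t := (X ^ 64 + X ^ 16 + X ^ 4 + X : F[X]).roots.toFinset)
        fun y hy => ?_) ((Multiset.toFinset_card_le _).trans ((card_roots' _).trans hdeg.le))
      rw [Multiset.mem_toFinset, mem_roots hne]
      simpa using hy
    · have h := Finset.card_le_mul_card_image (f := fun y : F => y ^ 64 + y ^ 16 + y ^ 4 + y)
        (Finset.univ.filter fun y : F => y ^ 2 ^ 8 = y)
        (Finset.univ.filter fun y : F => y ^ 64 + y ^ 16 + y ^ 4 + y = 0).card ?_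
      · have hs : ((Finset.univ.filter fun y : F => y ^ 2 ^ 8 = y).image
            fun y : F => y ^ 64 + y ^ 16 + y ^ 4 + y) ⊆
              Finset.univ.filter fun y : F => y ^ 2 ^ 2 = y := by
          intro z hz
          obtain ⟨y, hy, rfl⟩ := Finset.mem_image.mp hz
          have hy' := (Finset.mem_filter.mp hy).2
          refine Finset.mem_filter.mpr ⟨Finset.mem_univ _, CharTwo.add_eq_zero.mp ?_⟩
          rw [← CharTwo.add_eq_zero] at hy'
          exact (hR y).trans hy'
        have := h.trans (Nat.mul_le_mul_left _ (Finset.card_le_card hs))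
        rw [hcard, hcard'] at this
        omega
      · intro z hz
        obtain ⟨y, hy, rfl⟩ := Finset.mem_image.mp hz
        refine Finset.card_le_card_of_injOn (fun x => x + y) ?_ (fun _ _ _ _ h => add_right_cancel h)
        intro x hx
        have hx' := (Finset.mem_filter.mp hx).2
        refine Finset.mem_coe.mpr (Finset.mem_filter.mpr ⟨Finset.mem_univ _, ?_⟩)
        rw [hadd, hx', CharTwo.add_self_eq_zero]
  · have hg4 : (2 * n).gcd 4 = 2 * 2 := by
      rw [show 4 = 2 * 2 from rfl, Nat.gcd_mul_left, Nat.gcd_eq_right (by omega)]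
    rw [← hg4, ← card_pow_eq_self hq]
    congr 1
    ext y
    simp only [Finset.mem_filter, Finset.mem_univ, true_and]
    refine ⟨fun h => pow_eq_self_of_gcd_eq hq (by norm_num) ?_ (hR' h), fun h => ?_⟩
    · rw [hg4, hk8 2 (by omega)]
      rfl
    · have h64 : y ^ 64 = (y ^ 2 ^ 4) ^ 4 := by rw [← pow_mul]; norm_num
      have h16 : y ^ 16 = y ^ 2 ^ 4 := by norm_num
      rw [h64, h16, h]
      grind
  · have hg2 : (2 * n).gcd 2 = 2 * 1 := Nat.gcd_mul_right_left _ _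
    rw [← hg2, ← card_pow_eq_self hq]
    congr 1
    ext y
    simp only [Finset.mem_filter, Finset.mem_univ, true_and]
    refine ⟨fun h => pow_eq_self_of_gcd_eq hq (by norm_num) ?_ (hR' h), fun h => ?_⟩
    · rcases (by omega : n % 4 = 1 ∨ n % 4 = 3) with h1 | h1 <;> rw [hg2, hk8 _ h1] <;> rfl
    · have h4 : y ^ 4 = y := h
      have h16 : y ^ 16 = (y ^ 4) ^ 4 := by rw [← pow_mul]
      have h64 : y ^ 64 = (y ^ 16) ^ 4 := by rw [← pow_mul]
      rw [h64, h16, h4, h4, h4]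
      grind

theorem sum_chi_ninth_cube (hq : Fintype.card F = 2 ^ (2 * n)) :
    ∑ x : F, chi (x ^ 9 + x ^ 3) =
      (-2) ^ (n + if n % 4 = 0 then 3 else if n % 2 = 0 then 2 else 1) := by
  have h9 (x : F) : x ^ 9 = (x ^ 3) ^ 3 := by rw [← pow_mul]
  have h3 : (∑ x : F, chi (x ^ 9 + x ^ 3)) % 3 = 1 := by
    simp only [h9]
    exact sum_chi_cube_poly (p := fun x => x ^ 3 + x) hq (by simp)
  exact quadratic_sum_eq hq (pow_two_pow_bijective 3) chi_ninth_cube_add h3 (card_radical hq)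

/-- Translation by a primitive cube root of unity `w` negates every term, since `w` lies in the
radical of the cubic form, `χ(w³) = 1` and `χ(w) = -1`. -/
theorem sum_chi_cube_linear_of_odd (hq : Fintype.card F = 2 ^ (2 * n)) (hn : n % 2 = 1) :
    ∑ x : F, chi (x ^ 3 + x) = 0 := by
  have h2 := two_eq_zero (F := F)
  obtain ⟨w, hw⟩ := exists_cube_root_of_unity (tr_one_eq_zero hq)
  have hw4 : w ^ 2 ^ 2 = w := by grind
  have htw : chi w = -1 := by
    rw [chi_eq]
    rcases zmod_two_cases (tr w) with h | h
    -- If `w = y² + y`, then `y⁴ + y = w² + w = 1` and `y ∈ 𝔽₁₆`; but `F ∩ 𝔽₁₆ = 𝔽₄` for odd `n`,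
    -- forcing `y⁴ = y`.
    · exfalso
      obtain ⟨y, hy⟩ := exists_artinSchreier h
      have h16 : y ^ 2 ^ 4 = y := by grind
      have h4 : y ^ 2 ^ 2 = y := by
        refine pow_eq_self_of_gcd_eq hq (by norm_num) ?_ h16
        rw [show 4 = 2 * 2 from rfl, Nat.gcd_mul_left, Nat.gcd_mul_right_left, Nat.gcd_comm,
          Nat.gcd_rec, hn, Nat.gcd_one_left]
      grind
    · rw [h, sgn_one]
  have hs : ∑ x : F, chi ((x + w) ^ 3 + (x + w)) = ∑ x : F, chi (x ^ 3 + x) :=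
    Equiv.sum_comp (Equiv.addRight w) fun x => chi (x ^ 3 + x)
  have hx (x : F) : chi ((x + w) ^ 3 + (x + w)) = -chi (x ^ 3 + x) := by
    have hw3 : w ^ 3 = 1 := by grind
    have h1 : chi (1 : F) = 1 := by rw [chi_eq, tr_one_eq_zero hq, sgn_zero]
    rw [chi_add, chi_cube_add, chi_add x w, hw4, CharTwo.add_self_eq_zero, mul_zero, chi_zero, hw3,
      h1, htw, chi_add]
    ring
  simp only [hx, Finset.sum_neg_distrib] at hs
  omega

/-- The `m = kl` Frobenius conjugates of `z` repeat with period `k`, so the conjugate sum is `l`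
copies of one period. -/
theorem tr_eq_of_period {m k l : ℕ} (hq : Fintype.card F = 2 ^ m) (hm : m = k * l) {z : F}
    (hz : z ^ 2 ^ k = z) :
    algebraMap (ZMod 2) F (tr z) = l * ∑ i ∈ Finset.range k, z ^ 2 ^ i := by
  have hf : Module.finrank (ZMod 2) F = m := by
    have := Module.card_eq_pow_finrank (K := ZMod 2) (V := F)
    rw [hq, ZMod.card] at this
    exact (Nat.pow_right_injective le_rfl this).symm
  rw [tr, FiniteField.algebraMap_trace_eq_sum_pow, hf, Nat.card_eq_fintype_card, ZMod.card, hm]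
  clear hm hf
  induction l with
  | zero => simp
  | succ l ih =>
    have hkl : z ^ 2 ^ (k * l) = z := by
      clear ih
      induction l with
      | zero => simp
      | succ l ih => rw [mul_add_one, pow_add, pow_mul, ih, hz]
    rw [mul_add_one, Finset.sum_range_add, ih]
    simp only [pow_add 2 (k * l), pow_mul z, hkl]
    push_cast
    ring

/-- Choose `y ∈ 𝔽₁₆` with `y⁴ + y = 1`. Then `χ((x + y)³) = χ(y³) χ(x³ + x)`, so the sum is that of
`χ(x³)` up to the sign `χ(y³)`; `y³` has trace 1 over one period of length 4, which gives
`(-1)^(n/2)`. -/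
theorem sum_chi_cube_linear_of_even (hq : Fintype.card F = 2 ^ (2 * n)) (hn : n % 2 = 0) :
    ∑ x : F, chi (x ^ 3 + x) = (-1) ^ (n / 2) * (-2) ^ (n + 1) := by
  have h2 := two_eq_zero (F := F)
  obtain ⟨l, rfl⟩ : ∃ l, n = 2 * l := ⟨n / 2, by omega⟩
  obtain ⟨w, hw⟩ := exists_cube_root_of_unity (tr_one_eq_zero hq)
  have hw4 : w ^ 2 ^ 2 = w := by grind
  have htw : tr w = 0 := by
    have := tr_eq_of_period hq rfl (k := 2) (z := w) hw4
    refine (algebraMap (ZMod 2) F).injective ?_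
    rw [this, map_zero]
    push_cast
    rw [h2]
    ring
  obtain ⟨y, hy⟩ := exists_artinSchreier htw
  have h16 : y ^ 2 ^ 4 = y := by grind
  have h4 : y ^ 2 ^ 2 + y = 1 := by grind
  have hty : tr (y ^ 3) = l := by
    have := tr_eq_of_period hq (by ring) (k := 4) (l := l) (z := y ^ 3)
      (by rw [← pow_mul, mul_comm, pow_mul, h16])
    refine (algebraMap (ZMod 2) F).injective ?_
    rw [this, map_natCast]
    have h1 : ∑ i ∈ Finset.range 4, (y ^ 3) ^ 2 ^ i = 1 := by
      simp only [Finset.sum_range_succ, Finset.sum_range_zero]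
      grind
    rw [h1, mul_one]
  have hcy : chi (y ^ 3) = (-1) ^ l := by
    rw [chi_eq, hty, sgn, ZMod.val_natCast]
    exact (neg_one_pow_eq_pow_mod_two _).symm
  have hs : ∑ x : F, chi ((x + y) ^ 3) = ∑ x : F, chi (x ^ 3) :=
    Equiv.sum_comp (Equiv.addRight y) fun x => chi (x ^ 3)
  have hx (x : F) : chi ((x + y) ^ 3) = (-1) ^ l * chi (x ^ 3 + x) := by
    rw [chi_cube_add, h4, mul_one, chi_pow_two_pow, hcy, chi_add]
    ring
  simp only [hx, ← Finset.mul_sum] at hs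
  rw [sum_chi_cube hq] at hs
  rw [Nat.mul_div_cancel_left _ two_pos, ← hs, ← mul_assoc, ← mul_pow]
  norm_num

/-! ### Fibres of `x ↦ x⁴ + x³`. -/

theorem exists_cube_of_quartic_eq {x y : F} (h : y ^ 4 + y ^ 3 = x ^ 4 + x ^ 3) (hne : y ≠ x) :
    ∃ u : F, u ^ 3 = x + 1 := by
  have h2 := two_eq_zero (F := F)
  have hd : x + y ≠ 0 := fun h => hne (CharTwo.add_eq_zero.mp h).symm
  have h1 : (x + y) ^ 3 = x ^ 2 + x * y + y ^ 2 := by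
    refine mul_left_cancel₀ hd ?_
    grind
  -- Dividing the hypothesis by `d = x + y` gave `d³ = x² + xy + y²`, whence `(x + 1)d³ = y³`.
  refine ⟨y / (x + y), ?_⟩
  rw [div_pow, div_eq_iff (pow_ne_zero _ hd), h1]
  grind

theorem fourth_power_add (a b : F) : (a + b) ^ 4 = a ^ 4 + b ^ 4 := by
  have h2 := two_eq_zero (F := F)
  grind

/-- Otherwise `u + e` and `u + e'` differ by a nontrivial cube root of unity, a linear equation over
`𝔽₄` that puts `u` in `𝔽₄`. -/
theorem cube_translate_injective {w u e e' : F} (hw : w ^ 2 + w = 1) (hu : u ^ 4 ≠ u)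
    (he : e ^ 4 = e) (he' : e' ^ 4 = e') (h : (u + e) ^ 3 = (u + e') ^ 3) : e = e' := by
  have h2 := two_eq_zero (F := F)
  have hw4 : w ^ 4 = w := by grind
  rcases (cube_eq_cube_iff hw).mp h with h | h | h
  · exact add_left_cancel h
  · have h1 : u = w * (w * e' + e) := by grind
    refine absurd ?_ hu
    rw [h1, mul_pow, fourth_power_add, mul_pow, hw4, he, he']
  · have h1 : u = w ^ 2 * ((w + 1) * e' + e) := by grind
    refine absurd ?_ hu
    rw [h1, mul_pow, fourth_power_add, mul_pow, fourth_power_add, ← pow_mul, mul_comm 2 4, pow_mul,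
      hw4, he, he', one_pow]

theorem quartic_cube_add_one (u : F) : (u ^ 3 + 1) ^ 4 + (u ^ 3 + 1) ^ 3 = (u ^ 4 + u) ^ 3 := by
  have h2 := two_eq_zero (F := F)
  grind

theorem quartic_fiber {w u : F} (hw : w ^ 2 + w = 1) :
    (Finset.univ.filter fun y : F => y ^ 4 + y ^ 3 = (u ^ 3 + 1) ^ 4 + (u ^ 3 + 1) ^ 3) =
      (Finset.univ.filter fun e : F => e ^ 2 ^ 2 = e).image fun e => (u + e) ^ 3 + 1 := by
  have h2 := two_eq_zero (F := F)
  ext y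
  simp only [Finset.mem_filter, Finset.mem_univ, true_and, Finset.mem_image]
  constructor
  · intro h
    have h4 : (y - ((u + 0) ^ 3 + 1)) * (y - ((u + 1) ^ 3 + 1)) *
        ((y - ((u + w) ^ 3 + 1)) * (y - ((u + (w + 1)) ^ 3 + 1))) = 0 := by
      have ha : (y - ((u + 0) ^ 3 + 1)) * (y - ((u + 1) ^ 3 + 1)) =
        y ^ 2 + y * (u ^ 2 + u + 1) + (u ^ 3 + 1) * (u ^ 3 + u ^ 2 + u) := by grind
      have hb : (y - ((u + w) ^ 3 + 1)) * (y - ((u + (w + 1)) ^ 3 + 1)) =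
        y ^ 2 + y * (u ^ 2 + u) + (u ^ 6 + u ^ 5 + u ^ 3 + u ^ 2) := by grind
      rw [ha, hb]
      grind
    simp only [mul_eq_zero, sub_eq_zero] at h4
    rcases h4 with (h4 | h4) | h4 | h4
    · exact ⟨0, by simp, h4.symm⟩
    · exact ⟨1, by simp, h4.symm⟩
    · exact ⟨w, by grind, h4.symm⟩
    · exact ⟨w + 1, by grind, h4.symm⟩
  · rintro ⟨e, he, rfl⟩
    rw [quartic_cube_add_one, quartic_cube_add_one, fourth_power_add]
    norm_num only at he
    rw [he]
    congr 1
    grind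

theorem card_quartic_fiber (hq : Fintype.card F = 2 ^ (2 * n)) {u : F} (hu : u ^ 4 ≠ u) :
    (Finset.univ.filter fun y : F =>
      y ^ 4 + y ^ 3 = (u ^ 3 + 1) ^ 4 + (u ^ 3 + 1) ^ 3).card = 4 := by
  obtain ⟨w, hw⟩ := exists_cube_root_of_unity (tr_one_eq_zero hq)
  rw [quartic_fiber hw, Finset.card_image_of_injOn, card_pow_eq_self hq, Nat.gcd_mul_right_left]
  · rfl
  · intro e he e' he' h
    exact cube_translate_injective hw hu (Finset.mem_filter.mp he).2 (Finset.mem_filter.mp he').2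
      (add_right_cancel h)

theorem tr_add (x y : F) : tr (x + y) = tr x + tr y := map_add _ x y

theorem tr_eq_of_chi_eq {x y : F} (h : chi x = chi y) : tr x = tr y := by
  rw [chi_eq, chi_eq] at h
  generalize tr x = i at *
  generalize tr y = j at *
  revert i j
  decide

/-- Distinct points of a fibre have the form `(u + e)³ + 1` with `e ∈ 𝔽₄`. Such `e` lies in the
radical of `tr (u³)`, and `e³ ∈ {0, 1}` has trace 0. -/
theorem tr_eq_of_quartic_eq (hq : Fintype.card F = 2 ^ (2 * n)) {x y : F}
    (h : y ^ 4 + y ^ 3 = x ^ 4 + x ^ 3) : tr y = tr x := by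
  rcases eq_or_ne y x with rfl | hne
  · rfl
  obtain ⟨w, hw⟩ := exists_cube_root_of_unity (tr_one_eq_zero hq)
  obtain ⟨u, hu⟩ := exists_cube_of_quartic_eq h hne
  have h2 := two_eq_zero (F := F)
  obtain rfl : x = u ^ 3 + 1 := by grind
  have hy : y ∈ Finset.univ.filter fun y : F =>
    y ^ 4 + y ^ 3 = (u ^ 3 + 1) ^ 4 + (u ^ 3 + 1) ^ 3 := by simpa using h
  rw [quartic_fiber hw] at hy
  obtain ⟨e, he, rfl⟩ := Finset.mem_image.mp hy
  have he := (Finset.mem_filter.mp he).2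
  have he3 : tr (e ^ 3) = 0 := by
    rcases eq_or_ne e 0 with rfl | h0
    · simp [tr]
    · have : e ^ 3 = 1 := mul_right_cancel₀ h0 (by rw [← pow_succ, one_mul]; exact he)
      rw [this, tr_one_eq_zero hq]
  have hc := chi_cube_add u e
  rw [he, CharTwo.add_self_eq_zero, mul_zero, chi_zero, mul_one, ← chi_add] at hc
  rw [tr_add, tr_add, tr_eq_of_chi_eq hc, tr_add, he3, add_zero]

/-! ### Counting the image with prescribed traces. -/

/-- The elements `x ≠ 0, 1` with prescribed traces of `x` and `x⁴ + x³`. -/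
noncomputable def quarticPairs (F : Type*) [Field F] [Fintype F] [Algebra (ZMod 2) F]
    (i j : ZMod 2) : Finset F :=
  Finset.univ.filter fun x => x ^ 4 + x ^ 3 ≠ 0 ∧ tr x = i ∧ tr (x ^ 4 + x ^ 3) = j

theorem mem_quarticPairs {i j : ZMod 2} {x : F} : x ∈ quarticPairs F i j ↔
    x ^ 4 + x ^ 3 ≠ 0 ∧ tr x = i ∧ tr (x ^ 4 + x ^ 3) = j := by
  simp [quarticPairs]

/-- The elements `u` such that `u³ + 1` lies in `quarticPairs F i j`. -/
noncomputable def cubePairs (F : Type*) [Field F] [Fintype F] [Algebra (ZMod 2) F]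
    (i j : ZMod 2) : Finset F :=
  Finset.univ.filter fun u => u ^ 3 + 1 ∈ quarticPairs F i j

theorem mem_quarticPairs_of_quartic_eq (hq : Fintype.card F = 2 ^ (2 * n)) {i j : ZMod 2} {x y : F}
    (hx : x ∈ quarticPairs F i j) (h : y ^ 4 + y ^ 3 = x ^ 4 + x ^ 3) :
    y ∈ quarticPairs F i j := by
  rw [mem_quarticPairs] at hx ⊢
  rwa [h, tr_eq_of_quartic_eq hq h]

theorem card_cubePairs (hq : Fintype.card F = 2 ^ (2 * n)) (i j : ZMod 2) :
    (cubePairs F i j).card =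
      3 * ((quarticPairs F i j).filter fun x => ∃ u, u ^ 3 = x + 1).card := by
  have h2 := two_eq_zero (F := F)
  obtain ⟨w, hw⟩ := exists_cube_root_of_unity (tr_one_eq_zero hq)
  have himg : (cubePairs F i j).image (fun u => u ^ 3 + 1) =
      (quarticPairs F i j).filter fun x => ∃ u, u ^ 3 = x + 1 := by
    ext x
    simp only [Finset.mem_image, Finset.mem_filter, cubePairs, Finset.mem_univ, true_and]
    constructor
    · rintro ⟨u, hu, rfl⟩
      exact ⟨hu, u, by grind⟩
    · rintro ⟨hx, u, hu⟩
      have : u ^ 3 + 1 = x := by grind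
      exact ⟨u, this ▸ hx, this⟩
  rw [← himg, Finset.card_eq_sum_card_image (fun u : F => u ^ 3 + 1), mul_comm]
  refine Finset.sum_const_nat fun x hx => ?_
  obtain ⟨u, hu, rfl⟩ := Finset.mem_image.mp hx
  have hu' := (Finset.mem_filter.mp hu).2
  have hu0 : u ≠ 0 := by
    rintro rfl
    have := (mem_quarticPairs.mp hu').1
    grind
  refine Eq.trans ?_ (card_cube_fiber hw hu0)
  congr 1
  ext v
  simp only [Finset.mem_filter, Finset.mem_univ, true_and, add_left_inj, and_iff_right_iff_imp]
  intro h
  simpa [cubePairs, h] using hu'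

/-- Split into `C`, where `x + 1` is a cube, and `D`, where it is not. The map is four-to-one on
`C`, injective on `D`, and the two images are disjoint; moreover `cubePairs` has `3|C|` elements. -/
theorem four_mul_card_image_quarticPairs (hq : Fintype.card F = 2 ^ (2 * n)) (i j : ZMod 2) :
    4 * ((quarticPairs F i j).image fun x => x ^ 4 + x ^ 3).card + (cubePairs F i j).card =
      4 * (quarticPairs F i j).card := by
  have h2 := two_eq_zero (F := F)
  set f : F → F := fun x => x ^ 4 + x ^ 3
  set C := (quarticPairs F i j).filter fun x => ∃ u, u ^ 3 = x + 1 with hC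
  set D := (quarticPairs F i j).filter fun x => ¬∃ u, u ^ 3 = x + 1 with hD
  have hCD : C.card + D.card = (quarticPairs F i j).card :=
    Finset.card_filter_add_card_filter_not _
  have hfD : (D.image f).card = D.card := by
    refine Finset.card_image_of_injOn fun x hx y hy h => ?_
    by_contra hne
    exact (Finset.mem_filter.mp hx).2 (exists_cube_of_quartic_eq h.symm (Ne.symm hne))
  have hfC : C.card = (C.image f).card * 4 := by
    rw [Finset.card_eq_sum_card_image f C]
    refine Finset.sum_const_nat fun a ha => ?_
    obtain ⟨x, hx, rfl⟩ := Finset.mem_image.mp ha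
    obtain ⟨hx, u, hu⟩ := Finset.mem_filter.mp hx
    obtain rfl : x = u ^ 3 + 1 := by grind
    have hu4 : u ^ 4 ≠ u := by
      intro h
      refine (mem_quarticPairs.mp hx).1 ?_
      rw [quartic_cube_add_one, h, CharTwo.add_self_eq_zero, zero_pow three_ne_zero]
    refine Eq.trans ?_ (card_quartic_fiber hq hu4)
    congr 1
    ext y
    simp only [f, hC, Finset.mem_filter, Finset.mem_univ, true_and, and_iff_right_iff_imp]
    intro h
    refine ⟨mem_quarticPairs_of_quartic_eq hq hx h, ?_⟩
    rcases eq_or_ne (u ^ 3 + 1) y with rfl | hne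
    · exact ⟨u, hu⟩
    · exact exists_cube_of_quartic_eq h.symm hne
  have hdisj : Disjoint (C.image f) (D.image f) := by
    rw [Finset.disjoint_left]
    rintro _ hc hd
    obtain ⟨x, hx, rfl⟩ := Finset.mem_image.mp hc
    obtain ⟨y, hy, h⟩ := Finset.mem_image.mp hd
    rcases eq_or_ne x y with rfl | hne
    · exact (Finset.mem_filter.mp hy).2 (Finset.mem_filter.mp hx).2
    · exact (Finset.mem_filter.mp hy).2 (exists_cube_of_quartic_eq h.symm hne)
  have himg : (quarticPairs F i j).image f = C.image f ∪ D.image f := by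
    rw [← Finset.image_union, hC, hD, Finset.filter_union_filter_not_eq]
  rw [himg, Finset.card_union_of_disjoint hdisj, card_cubePairs hq, ← hC]
  omega

theorem tr_quartic (x : F) : tr (x ^ 4 + x ^ 3) = tr (x ^ 3 + x) := by
  rw [tr_add, tr_add, add_comm, show x ^ 4 = x ^ 2 ^ 2 by norm_num, tr_pow_two_pow]

theorem quartic_eq_zero_iff (x : F) : x ^ 4 + x ^ 3 = 0 ↔ x = 0 ∨ x = 1 := by
  have : x ^ 4 + x ^ 3 = x ^ 3 * (x + 1) := by ring
  rw [this, mul_eq_zero, CharTwo.add_eq_zero]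
  simp

/-- The correction `8 = 4 · 2` removes `x = 0, 1`, the zeros of `x⁴ + x³`, for which both traces
vanish. -/
theorem four_mul_card_quarticPairs (hq : Fintype.card F = 2 ^ (2 * n)) (i j : ZMod 2) :
    4 * ((quarticPairs F i j).card : ℤ) = 2 ^ (2 * n) + sgn j * ∑ x : F, chi (x ^ 3 + x) +
      sgn i * sgn j * ∑ x : F, chi (x ^ 3) - if i = 0 ∧ j = 0 then 8 else 0 := by
  have h := four_mul_card_pair (fun x : F => tr x) (fun x => tr (x ^ 3 + x)) i j
  have h3 (x : F) : chi x * chi (x ^ 3 + x) = chi (x ^ 3) := by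
    rw [chi_add, mul_left_comm, chi_mul_self, mul_one]
  simp only [← chi_eq, h3, sum_chi, hq] at h
  have hsplit := Finset.card_filter_add_card_filter_not
    (s := Finset.univ.filter fun x : F => tr x = i ∧ tr (x ^ 3 + x) = j)
    (fun x => x ^ 4 + x ^ 3 ≠ 0)
  have hX : ((Finset.univ.filter fun x : F => tr x = i ∧ tr (x ^ 3 + x) = j).filter
      fun x => x ^ 4 + x ^ 3 ≠ 0) = quarticPairs F i j := by
    ext x
    simp only [Finset.mem_filter, Finset.mem_univ, true_and, mem_quarticPairs, tr_quartic]
    tauto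
  have hZ : ((Finset.univ.filter fun x : F => tr x = i ∧ tr (x ^ 3 + x) = j).filter
      fun x => ¬x ^ 4 + x ^ 3 ≠ 0).card = if i = 0 ∧ j = 0 then 2 else 0 := by
    have ht1 : tr (1 : F) = 0 := tr_one_eq_zero hq
    have ht0 : tr (0 : F) = 0 := map_zero _
    have hmem (x : F) : x ∈ ((Finset.univ.filter fun x : F => tr x = i ∧ tr (x ^ 3 + x) = j).filter
        fun x => ¬x ^ 4 + x ^ 3 ≠ 0) ↔ (x = 0 ∨ x = 1) ∧ i = 0 ∧ j = 0 := by
      simp only [Finset.mem_filter, Finset.mem_univ, true_and, not_not, quartic_eq_zero_iff]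
      constructor
      · rintro ⟨⟨rfl, rfl⟩, rfl | rfl⟩ <;> simp [ht0, ht1, CharTwo.add_self_eq_zero]
      · rintro ⟨rfl | rfl, rfl, rfl⟩ <;> simp [ht0, ht1, CharTwo.add_self_eq_zero]
    split_ifs with hij
    · refine Eq.trans ?_ (Finset.card_pair (zero_ne_one (α := F)))
      congr 1
      ext x
      rw [hmem]
      simp [hij]
    · rw [Finset.card_eq_zero, Finset.eq_empty_iff_forall_notMem]
      intro x hx
      exact hij ((hmem x).mp hx).2
  rw [hX, hZ] at hsplit
  rw [← hsplit] at h
  split_ifs at h ⊢ <;> push_cast at h <;> linarith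

/-- The correction `16 = 4 · 4` removes `u ∈ 𝔽₄`, where `(u⁴ + u)³ = 0` and both traces vanish. -/
theorem four_mul_card_cubePairs (hq : Fintype.card F = 2 ^ (2 * n)) (i j : ZMod 2) :
    4 * ((cubePairs F i j).card : ℤ) = 2 ^ (2 * n) + sgn i * ∑ x : F, chi (x ^ 3) +
      sgn j * ∑ x : F, chi (x ^ 9 + x ^ 3) + sgn i * sgn j * ∑ x : F, chi (x ^ 9) -
        if i = 0 ∧ j = 0 then 16 else 0 := by
  have ht1 : tr (1 : F) = 0 := tr_one_eq_zero hq
  have ht0 : tr (0 : F) = 0 := map_zero _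
  have htr1 (u : F) : tr (u ^ 3 + 1) = tr (u ^ 3) := by rw [tr_add, ht1, add_zero]
  have htr2 (u : F) : tr ((u ^ 3 + 1) ^ 4 + (u ^ 3 + 1) ^ 3) = tr (u ^ 9 + u ^ 3) := by
    have h2 := two_eq_zero (F := F)
    have : (u ^ 3 + 1) ^ 3 + (u ^ 3 + 1) = u ^ 9 + ((u ^ 3) ^ 2 + 0) := by grind
    rw [tr_quartic, this, add_zero, tr_add, tr_add, tr_sq]
  have h := four_mul_card_pair (fun u : F => tr (u ^ 3)) (fun u => tr (u ^ 9 + u ^ 3)) i j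
  have h3 (x : F) : chi (x ^ 3) * chi (x ^ 9 + x ^ 3) = chi (x ^ 9) := by
    rw [chi_add, mul_left_comm, chi_mul_self, mul_one]
  simp only [← chi_eq, h3, hq] at h
  have hsplit := Finset.card_filter_add_card_filter_not
    (s := Finset.univ.filter fun u : F => tr (u ^ 3) = i ∧ tr (u ^ 9 + u ^ 3) = j)
    (fun u => (u ^ 3 + 1) ^ 4 + (u ^ 3 + 1) ^ 3 ≠ 0)
  have hX : ((Finset.univ.filter fun u : F => tr (u ^ 3) = i ∧ tr (u ^ 9 + u ^ 3) = j).filter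
      fun u => (u ^ 3 + 1) ^ 4 + (u ^ 3 + 1) ^ 3 ≠ 0) = cubePairs F i j := by
    ext x
    simp only [Finset.mem_filter, Finset.mem_univ, true_and, cubePairs, mem_quarticPairs, htr1,
      htr2]
    tauto
  have hZ : ((Finset.univ.filter fun u : F => tr (u ^ 3) = i ∧ tr (u ^ 9 + u ^ 3) = j).filter
      fun u => ¬(u ^ 3 + 1) ^ 4 + (u ^ 3 + 1) ^ 3 ≠ 0).card = if i = 0 ∧ j = 0 then 4 else 0 := by
    have hmem (u : F) : u ∈ ((Finset.univ.filter fun u : F =>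
        tr (u ^ 3) = i ∧ tr (u ^ 9 + u ^ 3) = j).filter
        fun u => ¬(u ^ 3 + 1) ^ 4 + (u ^ 3 + 1) ^ 3 ≠ 0) ↔ u ^ 2 ^ 2 = u ∧ i = 0 ∧ j = 0 := by
      simp only [Finset.mem_filter, Finset.mem_univ, true_and, not_not, quartic_cube_add_one,
        pow_eq_zero_iff three_ne_zero, CharTwo.add_eq_zero]
      have h0 : u ^ 4 = u → tr (u ^ 3) = 0 ∧ tr (u ^ 9 + u ^ 3) = 0 := by
        intro hu
        have h9 : u ^ 9 = u ^ 3 := by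
          have : u ^ 9 = (u ^ 4) ^ 2 * u := by ring
          rw [this, hu, ← pow_succ]
        rw [h9, CharTwo.add_self_eq_zero]
        rcases eq_or_ne u 0 with rfl | h0
        · simp [tr]
        · have : u ^ 3 = 1 := mul_right_cancel₀ h0 (by rw [← pow_succ, one_mul]; exact hu)
          exact ⟨this ▸ ht1, ht0⟩
      constructor
      · rintro ⟨⟨rfl, rfl⟩, hu⟩
        exact ⟨hu, h0 hu⟩
      · rintro ⟨hu, rfl, rfl⟩
        exact ⟨h0 hu, hu⟩
    split_ifs with hij
    · have hc := card_pow_eq_self (k := 2) hq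
      rw [Nat.gcd_mul_right_left] at hc
      refine Eq.trans ?_ hc
      congr 1
      ext x
      rw [hmem]
      simp [hij]
    · rw [Finset.card_eq_zero, Finset.eq_empty_iff_forall_notMem]
      intro x hx
      exact hij ((hmem x).mp hx).2
  rw [hX, hZ] at hsplit
  rw [← hsplit] at h
  split_ifs at h ⊢ <;> push_cast at h <;> linarith

/-! ### From residues of Kloosterman sums to the table. -/

theorem card_mod_three (hq : Fintype.card F = 2 ^ (2 * n)) : Fintype.card F % 3 = 1 := by
  rw [hq, pow_mul, Nat.pow_mod]
  norm_num

/-- The Kloosterman sum residues prime to three in terms of the roots of `x⁴ + x³ = a`. -/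
theorem kloosterman_modEq_iff (hn : 2 ≤ n) (hq : Fintype.card F = 2 ^ (2 * n)) {i j : ZMod 2}
    {k : ℤ} (h3 : k % 3 = if i = 0 then 1 else 2) (h8 : k % 8 = if j = 0 then 7 else 3)
    {a : F} (ha : a ≠ 0) :
    kloosterman a ≡ k [ZMOD 24] ↔ tr a = j ∧ ∃ x : F, x ^ 4 + x ^ 3 = a ∧ tr x = i := by
  have hq8 : 8 ∣ Fintype.card F := by
    rw [hq]
    exact pow_dvd_pow 2 (by omega : 3 ≤ 2 * n)
  have hi : (∃ x : F, x ^ 4 + x ^ 3 = a ∧ tr x = i) ↔ kloosterman a % 3 = k % 3 := by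
    obtain ⟨h0, h1⟩ := kloosterman_mod_three ha (card_mod_three hq)
    rcases zmod_two_cases i with rfl | rfl
    · rw [← h0, h3, if_pos rfl]
    · rw [← h1, h3, if_neg one_ne_zero]
  have hj : tr a = j ↔ kloosterman a % 8 = k % 8 := by
    rw [kloosterman_mod_eight ha hq8, h8]
    rcases zmod_two_cases (tr a) with h | h <;> rcases zmod_two_cases j with rfl | rfl <;> simp [h]
  rw [hi, hj, Int.ModEq]
  omega

theorem count_eq_card_image (hn : 2 ≤ n) (hq : Fintype.card F = 2 ^ (2 * n)) {i j : ZMod 2}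
    {k : ℤ} (h3 : k % 3 = if i = 0 then 1 else 2) (h8 : k % 8 = if j = 0 then 7 else 3) :
    count F k = ((quarticPairs F i j).image fun x => x ^ 4 + x ^ 3).card := by
  rw [count, Nat.card_eq_fintype_card, Fintype.card_subtype]
  congr 1
  ext a
  simp only [Finset.mem_filter, Finset.mem_univ, true_and, Finset.mem_image, mem_quarticPairs]
  constructor
  · rintro ⟨ha, h⟩
    obtain ⟨hj, x, rfl, hi⟩ := (kloosterman_modEq_iff hn hq h3 h8 ha).mp h
    exact ⟨x, ⟨ha, hi, hj⟩, rfl⟩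
  · rintro ⟨x, ⟨ha, hi, hj⟩, rfl⟩
    exact ⟨ha, (kloosterman_modEq_iff hn hq h3 h8 ha).mpr ⟨hj, x, rfl, hi⟩⟩

/-- Here `16 N(k) = 16 |quarticPairs| - 4 |cubePairs|`, with main term `4q - q = 3q` and, for `i = j
= 0`, correction `-32 + 16 = -16`: the source of the `-1` in the column of 7. -/
theorem sixteen_mul_deviation (hn : 2 ≤ n) (hq : Fintype.card F = 2 ^ (2 * n)) {i j : ZMod 2}
    {k : ℤ} (h3 : k % 3 = if i = 0 then 1 else 2) (h8 : k % 8 = if j = 0 then 7 else 3) :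
    16 * deviation F (2 * n) k = ((4 * sgn j * ∑ x : F, chi (x ^ 3 + x) +
      (4 * sgn i * sgn j - sgn i) * ∑ x : F, chi (x ^ 3) - sgn j * ∑ x : F, chi (x ^ 9 + x ^ 3) -
        sgn i * sgn j * ∑ x : F, chi (x ^ 9) - if i = 0 ∧ j = 0 then 16 else 0 : ℤ) : ℚ) := by
  have hA : (16 * (count F k : ℤ)) = 3 * 2 ^ (2 * n) + (4 * sgn j * ∑ x : F, chi (x ^ 3 + x) +
      (4 * sgn i * sgn j - sgn i) * ∑ x : F, chi (x ^ 3) - sgn j * ∑ x : F, chi (x ^ 9 + x ^ 3) -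
        sgn i * sgn j * ∑ x : F, chi (x ^ 9) - if i = 0 ∧ j = 0 then 16 else 0 : ℤ) := by
    have h := four_mul_card_image_quarticPairs hq i j
    rw [← count_eq_card_image hn hq h3 h8] at h
    have hX := four_mul_card_quarticPairs hq i j
    have hU := four_mul_card_cubePairs hq i j
    zify at h
    split_ifs at hX hU ⊢ <;> linear_combination 4 * h + 4 * hX - hU
  have hA' : (16 * (count F k : ℚ)) = ((16 * (count F k : ℤ) : ℤ) : ℚ) := by push_cast; rfl
  have hz : (2 : ℚ) ^ (((2 * n : ℕ) : ℤ) - 4) = 2 ^ (2 * n) / 16 := by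
    rw [zpow_sub₀ two_ne_zero, zpow_natCast]
    norm_num
  rw [deviation, mul_sub, hA', hA, hz]
  push_cast
  ring

theorem halfPow_two_mul (j : ℕ) : halfPow (2 * n) j = 2 ^ n / 2 ^ j := by
  rw [halfPow, Nat.mul_div_cancel_left _ two_pos, zpow_sub₀ two_ne_zero, zpow_natCast, zpow_natCast]

/-- The four deviations in terms of the exponential sums. -/
theorem deviation_table (hn : 2 ≤ n) (hq : Fintype.card F = 2 ^ (2 * n)) {c₁ c₃ c₉ c : ℤ}
    (h₁ : ∑ x : F, chi (x ^ 3 + x) = c₁ * 2 ^ n) (h₃ : ∑ x : F, chi (x ^ 3) = c₃ * 2 ^ n)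
    (h₉ : ∑ x : F, chi (x ^ 9) = c₉ * 2 ^ n)
    (h : ∑ x : F, chi (x ^ 9 + x ^ 3) = c * 2 ^ n) :
    deviation F (2 * n) 7 = (4 * c₁ + 3 * c₃ - c - c₉) / 16 * 2 ^ n - 1 ∧
    deviation F (2 * n) 19 = (-4 * c₁ - 5 * c₃ + c + c₉) / 16 * 2 ^ n ∧
    deviation F (2 * n) 11 = (-4 * c₁ + 5 * c₃ + c - c₉) / 16 * 2 ^ n ∧
    deviation F (2 * n) 23 = (4 * c₁ - 3 * c₃ - c + c₉) / 16 * 2 ^ n := by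
  have h7 := sixteen_mul_deviation hn hq (i := 0) (j := 0) (k := 7) rfl rfl
  have h19 := sixteen_mul_deviation hn hq (i := 0) (j := 1) (k := 19) rfl rfl
  have h11 := sixteen_mul_deviation hn hq (i := 1) (j := 1) (k := 11) rfl rfl
  have h23 := sixteen_mul_deviation hn hq (i := 1) (j := 0) (k := 23) rfl rfl
  simp only [h₁, h₃, h₉, h, sgn_zero, sgn_one, one_ne_zero, and_false, false_and, and_self,
    if_true, if_false] at h7 h19 h11 h23
  push_cast at h7 h19 h11 h23
  refine ⟨?_, ?_, ?_, ?_⟩ <;> linarith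

theorem neg_two_pow_add (k : ℕ) : (-2 : ℤ) ^ (n + k) = (-1) ^ n * (-2) ^ k * 2 ^ n := by
  rw [pow_add, neg_pow 2 n]
  ring

theorem neg_one_pow_of_mod_two_eq {N : ℕ} {r : ℕ} (h : N % 2 = r) : (-1 : ℤ) ^ N = (-1) ^ r := by
  rw [neg_one_pow_eq_pow_mod_two, h]

end KloostermanMod24

theorem theorem13 {F : Type*} [Field F] [Fintype F] [Algebra (ZMod 2) F]
    (m : ℕ) (hm : 2 < m) (hme : Even m) (hq : Fintype.card F = 2 ^ m) :
    (m % 24 = 0 →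
      KloostermanMod24.deviation F m 7 = KloostermanMod24.halfPow m 3 - 1 ∧
      KloostermanMod24.deviation F m 19 = KloostermanMod24.halfPow m 3 ∧
      KloostermanMod24.deviation F m 11 = - KloostermanMod24.halfPow m 3 ∧
      KloostermanMod24.deviation F m 23 = - KloostermanMod24.halfPow m 3) ∧
    (m % 24 = 6 ∨ m % 24 = 18 →
      KloostermanMod24.deviation F m 7 = - KloostermanMod24.halfPow m 2 - 1 ∧
      KloostermanMod24.deviation F m 19 = 0 ∧
      KloostermanMod24.deviation F m 11 = KloostermanMod24.halfPow m 2 ∧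
      KloostermanMod24.deviation F m 23 = 0) ∧
    (m % 24 = 12 →
      KloostermanMod24.deviation F m 7 = 3 * KloostermanMod24.halfPow m 3 - 1 ∧
      KloostermanMod24.deviation F m 19 = - KloostermanMod24.halfPow m 3 ∧
      KloostermanMod24.deviation F m 11 = - 3 * KloostermanMod24.halfPow m 3 ∧
      KloostermanMod24.deviation F m 23 = KloostermanMod24.halfPow m 3) ∧
    (m % 24 = 8 ∨ m % 24 = 16 →
      KloostermanMod24.deviation F m 7 = - KloostermanMod24.halfPow m 2 - 1 ∧
      KloostermanMod24.deviation F m 19 = KloostermanMod24.halfPow m 1 ∧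
      KloostermanMod24.deviation F m 11 = - KloostermanMod24.halfPow m 1 ∧
      KloostermanMod24.deviation F m 23 = KloostermanMod24.halfPow m 2) ∧
    (m % 24 = 2 ∨ m % 24 = 22 ∨ m % 24 = 10 ∨ m % 24 = 14 →
      KloostermanMod24.deviation F m 7 = KloostermanMod24.halfPow m 3 - 1 ∧
      KloostermanMod24.deviation F m 19 = - 3 * KloostermanMod24.halfPow m 3 ∧
      KloostermanMod24.deviation F m 11 = 5 * KloostermanMod24.halfPow m 3 ∧
      KloostermanMod24.deviation F m 23 = - 3 * KloostermanMod24.halfPow m 3) ∧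
    (m % 24 = 4 ∨ m % 24 = 20 →
      KloostermanMod24.deviation F m 7 = - 1 ∧
      KloostermanMod24.deviation F m 19 = KloostermanMod24.halfPow m 2 ∧
      KloostermanMod24.deviation F m 11 = - 3 * KloostermanMod24.halfPow m 2 ∧
      KloostermanMod24.deviation F m 23 = KloostermanMod24.halfPow m 1) := by
  open KloostermanMod24 in
  obtain ⟨n, rfl⟩ : ∃ n, m = 2 * n := ⟨m / 2, by have := Nat.even_iff.mp hme; omega⟩
  have hn : 2 ≤ n := by omega
  have p1 : halfPow (2 * n) 1 = 2 ^ n / 2 := (halfPow_two_mul 1).trans (by norm_num)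
  have p2 : halfPow (2 * n) 2 = 2 ^ n / 4 := (halfPow_two_mul 2).trans (by norm_num)
  have p3 : halfPow (2 * n) 3 = 2 ^ n / 8 := (halfPow_two_mul 3).trans (by norm_num)
  have s3 := sum_chi_cube hq
  have s9 := sum_chi_ninth hq
  have s := sum_chi_ninth_cube hq
  rw [neg_two_pow_add] at s3 s9 s
  rw [p1, p2, p3]
  -- The class of `m = 2n` modulo 24 enters only through `n` mod 4 and whether `3 ∣ n`.
  rcases Nat.mod_two_eq_zero_or_one n with hn2 | hn2
  · have s1 := sum_chi_cube_linear_of_even hq hn2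
    rw [neg_two_pow_add, ← mul_assoc] at s1
    obtain ⟨d7, d19, d11, d23⟩ := deviation_table hn hq s1 s3 s9 s
    rw [d7, d19, d11, d23]
    rw [neg_one_pow_of_mod_two_eq hn2]
    refine ⟨?_, ?_, ?_, ?_, ?_, ?_⟩
    all_goals intro hm
    · rw [neg_one_pow_of_mod_two_eq (show n / 2 % 2 = 0 by omega), if_pos (show n % 4 = 0 by omega),
        if_pos (show 3 ∣ n by omega)]
      refine ⟨?_, ?_, ?_, ?_⟩ <;> push_cast <;> ring
    · omega
    · rw [neg_one_pow_of_mod_two_eq (show n / 2 % 2 = 1 by omega), if_neg (show ¬n % 4 = 0 by omega),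
        if_pos hn2,
        if_pos (show 3 ∣ n by omega)]
      refine ⟨?_, ?_, ?_, ?_⟩ <;> push_cast <;> ring
    · rw [neg_one_pow_of_mod_two_eq (show n / 2 % 2 = 0 by omega), if_pos (show n % 4 = 0 by omega),
        if_neg (show ¬3 ∣ n by omega)]
      refine ⟨?_, ?_, ?_, ?_⟩ <;> push_cast <;> ring
    · omega
    · rw [neg_one_pow_of_mod_two_eq (show n / 2 % 2 = 1 by omega), if_neg (show ¬n % 4 = 0 by omega),
        if_pos hn2,
        if_neg (show ¬3 ∣ n by omega)]
      refine ⟨?_, ?_, ?_, ?_⟩ <;> push_cast <;> ring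
  · have s1 := sum_chi_cube_linear_of_odd hq hn2
    rw [← zero_mul (2 ^ n)] at s1
    obtain ⟨d7, d19, d11, d23⟩ := deviation_table hn hq s1 s3 s9 s
    rw [d7, d19, d11, d23]
    rw [neg_one_pow_of_mod_two_eq hn2, if_neg (show ¬n % 4 = 0 by omega),
      if_neg (show ¬n % 2 = 0 by omega)]
    refine ⟨?_, ?_, ?_, ?_, ?_, ?_⟩
    all_goals intro hm
    · omega
    · rw [if_pos (show 3 ∣ n by omega)]
      refine ⟨?_, ?_, ?_, ?_⟩ <;> push_cast <;> ring
    · omega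
    · omega
    · rw [if_neg (show ¬3 ∣ n by omega)]
      refine ⟨?_, ?_, ?_, ?_⟩ <;> push_cast <;> ring
    · omega
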